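/- Let $\beta>1$ be a Pisot number, i.e. a real algebraic integer greater than $1$ all of whose other Galois conjugates have modulus less than $1$, and let $C\subset\mathbb{Z}$ be a finite alphabet. For a word $u=u_k\cdots u_0\star u_{-1}u_{-2}\cdots$ of integer digits in which the symbol $\star$ occurs once and is preceded by a nonempty finite word, put $\mathrm{val}_\beta(u)=\sum_{-\infty<i\le k}u_i\beta^i$. Let $A_\beta=\{0,\dots,\lceil\beta\rceil-1\}$, $\bar A_\beta=\{-a : a\in A_\beta\}$ and $\tilde A_\beta=A_\beta\cup\bar A_\beta$. For $x\ge 0$, the $\beta$-expansion $d_\beta(x)=x_k\cdots x_0\star x_{-1}x_{-2}\cdots$ is the word with digits in $A_\beta$ and value $x$ such that $\sum_{-\infty<i\le\ell}x_i\beta^i<\beta^{\ell+1}$ for all $\ell\le k$, with $k\ge 0$ minimal; for $x<0$, $d_\beta(x)$ is obtained from $d_\beta(-x)$ by replacing every digit by its opposite. A letter-to-letter transducer with an initial function is a tuple $(Q,A,B,E,\alpha,T)$, where $Q$ is a finite set of states, $E\subseteq Q\times(A\times B)\times Q$ is the set of labeled edges, $T\subseteq Q$ is the set of terminal states and $\alpha$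 is a partial function from $Q$ to $A^*\times B^*$. It accepts a pair $(u,v)\in A^\omega\times B^\omega$ if there are $q\in\mathrm{dom}(\alpha)$ and $(u',v')\in A^\omega\times B^\omega$ such that $(u,v)=\alpha(q)(u',v')$ and $(u',v')$ labels an infinite path that starts in $q$ and goes infinitely often through terminal states. Then there is a (non-deterministic) letter-to-letter transducer $\mathcal{T}$ with input alphabet $C\cup\{\star\}$, output alphabet $\tilde A_\beta\cup\{\star\}$ and an initial function with values in $\{\varepsilon\}\times\tilde A_\beta^*$ that realizes the normalization $\nu_{\beta,C}$ in the following sense: for every infinite word $u\in C^+\star C^\omega$ there is a unique infinite word $v\in(\tilde A_\beta\cup\{\star\})^\omega$ such that $(u,v)$ is accepted by $\mathcal{T}$, and moreover $v\in 0^*d_\beta(\mathrm{val}_\beta(u))$, i.e. $v$ is the $\beta$-expansion of the value of $u$ preceded by finitely many (possibly no) zeros. -/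

import Mathlib

open scoped Stream'

/-- A Pisot number: a real algebraic integer greater than `1`, all of whose other Galois
conjugates have modulus less than `1`. -/
structure IsPisot (β : ℝ) : Prop where
  isIntegral : IsIntegral ℤ β
  one_lt : 1 < β
  conj_lt : ∀ z : ℂ, Polynomial.aeval z (minpoly ℚ β) = 0 → z ≠ (β : ℂ) → ‖z‖ < 1

/-- The words `u_k ⋯ u_0 ⋆ u_{-1} u_{-2} ⋯` in `D⁺ ⋆ D^ω`: `int` is the nonempty finite word
`u_k ⋯ u_0` and `frac` is the infinite word `u_{-1} u_{-2} ⋯`. -/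
@[ext]
structure PointedWord (D : Type) where
  int : List D
  int_ne_nil : int ≠ []
  frac : Stream' D

namespace PointedWord

variable {D D' : Type}

/-- The word as an infinite word over the alphabet `D ∪ {⋆}`. The letter `⋆` is `none`. -/
def toStream (w : PointedWord D) : Stream' (Option D) :=
  w.int.map some ++ₛ (none :: w.frac.map some)

/-- The word with the symbol `⋆` erased: `digits j` is the digit of exponent `k - j`, where
`k + 1` is the length of `int`. -/
def digits (w : PointedWord D) : Stream' D := w.int ++ₛ w.frac

/-- Letter-by-letter image. -/
def map (f : D → D') (w : PointedWord D) : PointedWord D' where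
  int := w.int.map f
  int_ne_nil := by simpa using w.int_ne_nil
  frac := w.frac.map f

/-- The tail sum `∑_{i ≤ k - j} u_i β^i` of a word `u_k ⋯ u_0 ⋆ u_{-1} ⋯` of integer digits. -/
noncomputable def tailVal (β : ℝ) (w : PointedWord ℤ) (j : ℕ) : ℝ :=
  ∑' i : ℕ, (w.digits.get (j + i) : ℝ) * β ^ ((w.int.length : ℤ) - 1 - ((j + i : ℕ) : ℤ))

/-- The value `∑_{i ≤ k} u_i β^i` of a word `u_k ⋯ u_0 ⋆ u_{-1} ⋯` of integer digits. -/
noncomputable def val (β : ℝ) (w : PointedWord ℤ) : ℝ := w.tailVal β 0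

end PointedWord

/-- The canonical alphabet `A_β = {0, …, ⌈β⌉ - 1}`. -/
noncomputable def canonicalAlphabet (β : ℝ) : Finset ℤ := Finset.Icc 0 (⌈β⌉ - 1)

/-- The signed alphabet, the union of `A_β` and `-A_β`. -/
noncomputable def signedAlphabet (β : ℝ) : Finset ℤ :=
  canonicalAlphabet β ∪ (canonicalAlphabet β).image (fun a => -a)

/-- `w = x_k ⋯ x_0 ⋆ x_{-1} ⋯` is a representation of `x` with digits in `A_β` such that
`∑_{i ≤ ℓ} x_i β^i < β^(ℓ+1)` for all `ℓ ≤ k` (below, `ℓ = k - j`). -/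
structure IsGreedyRep (β x : ℝ) (w : PointedWord ℤ) : Prop where
  val_eq : w.val β = x
  mem_alphabet : ∀ j, w.digits.get j ∈ canonicalAlphabet β
  tail_lt : ∀ j : ℕ, w.tailVal β j < β ^ ((w.int.length : ℤ) - (j : ℤ))

/-- `w` is the `β`-expansion of the nonnegative real `x`: the greedy representation with the
smallest possible number `k + 1 ≥ 1` of digits before `⋆`. -/
def IsNonnegExpansion (β x : ℝ) (w : PointedWord ℤ) : Prop :=
  IsGreedyRep β x w ∧ ∀ w', IsGreedyRep β x w' → w.int.length ≤ w'.int.length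

/-- `w` is the `β`-expansion of the real `x`. For `x < 0` it is the digitwise opposite of the
`β`-expansion of `-x`. -/
def IsExpansion (β x : ℝ) (w : PointedWord ℤ) : Prop :=
  (0 ≤ x ∧ IsNonnegExpansion β x w) ∨
    (x < 0 ∧ IsNonnegExpansion β (-x) (w.map fun a => -a))

namespace PointedWord

theorem ext_digits {D : Type} {w w' : PointedWord D} (hl : w.int.length = w'.int.length)
    (hd : w.digits = w'.digits) : w = w' := by
  obtain ⟨a, ha, f⟩ := w
  obtain ⟨b, hb, g⟩ := w'
  simp only [digits] at hl hd
  have h1 : f = g := by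
    have := congrArg (Stream'.drop a.length) hd
    rw [Stream'.drop_append_stream, hl, Stream'.drop_append_stream] at this
    exact this
  have h2 : a = b := by
    have := congrArg (Stream'.take a.length) hd
    rw [Stream'.take_append_of_le_length _ _ _ le_rfl,
      Stream'.take_append_of_le_length _ _ _ hl.le, List.take_length, hl,
      List.take_length] at this
    exact this
  subst h1 h2
  rfl

theorem map_neg_map_neg (w : PointedWord ℤ) :
    (w.map fun a => -a).map (fun a => -a) = w := by
  obtain ⟨a, ha, f⟩ := w
  simp [map, Stream'.map_map]

/-- The tail sums satisfy `∑_{i ≤ ℓ} = x_ℓ β^ℓ + ∑_{i ≤ ℓ - 1}`. -/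
theorem tailVal_succ {β : ℝ} (hβ : 1 < β) {w : PointedWord ℤ}
    (hw : ∀ j, w.digits.get j ∈ canonicalAlphabet β) (j : ℕ) :
    w.tailVal β j = (w.digits.get j : ℝ) * β ^ ((w.int.length : ℤ) - 1 - (j : ℤ)) +
      w.tailVal β (j + 1) := by
  have h0 : 0 < β := by linarith
  have hs : Summable fun i : ℕ =>
      (w.digits.get (j + i) : ℝ) * β ^ ((w.int.length : ℤ) - 1 - ((j + i : ℕ) : ℤ)) := by
    have hg : Summable fun i : ℕ =>
        ((⌈β⌉ : ℝ) * β ^ ((w.int.length : ℤ) - 1 - (j : ℤ))) * (β⁻¹) ^ i :=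
      (summable_geometric_of_lt_one (by positivity) (inv_lt_one_of_one_lt₀ hβ)).mul_left _
    refine Summable.of_nonneg_of_le (fun i => ?_) (fun i => ?_) hg
    · have := (Finset.mem_Icc.1 (hw (j + i))).1
      have : (0 : ℝ) ≤ (w.digits.get (j + i) : ℝ) := by exact_mod_cast this
      positivity
    · have h2 := (Finset.mem_Icc.1 (hw (j + i))).2
      have h3 : (w.digits.get (j + i) : ℝ) ≤ ⌈β⌉ := by
        have : w.digits.get (j + i) ≤ ⌈β⌉ := by omega
        exact_mod_cast this
      have h4 : β ^ ((w.int.length : ℤ) - 1 - ((j + i : ℕ) : ℤ)) =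
          β ^ ((w.int.length : ℤ) - 1 - (j : ℤ)) * (β⁻¹) ^ i := by
        rw [inv_pow, ← zpow_natCast, ← zpow_neg, ← zpow_add₀ h0.ne']
        congr 1
        push_cast
        ring
      rw [h4, mul_assoc]
      exact mul_le_mul_of_nonneg_right h3 (by positivity)
  unfold tailVal
  rw [hs.tsum_eq_zero_add]
  congr 1
  refine tsum_congr fun i => ?_
  have : j + (i + 1) = j + 1 + i := by omega
  rw [this]

theorem tailVal_nonneg {β : ℝ} (hβ : 1 < β) {w : PointedWord ℤ}
    (hw : ∀ j, w.digits.get j ∈ canonicalAlphabet β) (j : ℕ) : 0 ≤ w.tailVal β j := by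
  refine tsum_nonneg fun i => ?_
  have := (Finset.mem_Icc.1 (hw (j + i))).1
  have : (0 : ℝ) ≤ (w.digits.get (j + i) : ℝ) := by exact_mod_cast this
  have h0 : 0 < β := by linarith
  positivity

end PointedWord

theorem IsGreedyRep.unique {β x : ℝ} (hβ : 1 < β) {w w' : PointedWord ℤ}
    (h : IsGreedyRep β x w) (h' : IsGreedyRep β x w')
    (hl : w.int.length = w'.int.length) : w = w' := by
  have h0 : 0 < β := by linarith
  have key : ∀ w : PointedWord ℤ, IsGreedyRep β x w → ∀ j,
      w.digits.get j = ⌊w.tailVal β j / β ^ ((w.int.length : ℤ) - 1 - (j : ℤ))⌋ := by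
    intro w h j
    have hp : 0 < β ^ ((w.int.length : ℤ) - 1 - (j : ℤ)) := by positivity
    symm
    rw [Int.floor_eq_iff, le_div_iff₀ hp, div_lt_iff₀ hp,
      PointedWord.tailVal_succ hβ h.mem_alphabet j]
    have h1 := PointedWord.tailVal_nonneg hβ h.mem_alphabet (j + 1)
    have h2 := h.tail_lt (j + 1)
    have h3 : (w.int.length : ℤ) - ((j + 1 : ℕ) : ℤ) = (w.int.length : ℤ) - 1 - (j : ℤ) := by
      push_cast; ring
    rw [h3] at h2
    constructor <;> nlinarith
  have ht : ∀ j, w.tailVal β j = w'.tailVal β j := by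
    intro j
    induction j with
    | zero => exact h.val_eq.trans h'.val_eq.symm
    | succ j ih =>
      have e1 := PointedWord.tailVal_succ hβ h.mem_alphabet j
      have e2 := PointedWord.tailVal_succ hβ h'.mem_alphabet j
      rw [key w h j] at e1
      rw [key w' h' j, ← ih, ← hl] at e2
      linarith
  refine PointedWord.ext_digits hl (Stream'.ext fun j => ?_)
  rw [key w h j, key w' h' j, ht j, hl]

theorem exists_isGreedyRep {β x : ℝ} (hβ : 1 < β) (hx : 0 ≤ x) :
    ∃ w, IsGreedyRep β x w := by
  have h0 : 0 < β := by linarith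
  obtain ⟨n, hn⟩ := pow_unbounded_of_one_lt x hβ
  let m := n + 1
  have hm : x < β ^ m := hn.trans_le (pow_le_pow_right₀ hβ.le (Nat.le_succ n))
  let y : ℕ → ℝ := fun j => Nat.rec (x / β ^ m) (fun _ r => Int.fract (β * r)) j
  have ys : ∀ j, y (j + 1) = Int.fract (β * y j) := fun j => rfl
  have y01 : ∀ j, 0 ≤ y j ∧ y j < 1 := by
    intro j
    cases j with
    | zero =>
      exact ⟨show 0 ≤ x / β ^ m by positivity,
        show x / β ^ m < 1 from (div_lt_one (by positivity)).2 hm⟩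
    | succ j => exact ⟨Int.fract_nonneg _, Int.fract_lt_one _⟩
  let d : Stream' ℤ := fun j => ⌊β * y j⌋
  have dd : ∀ j, (d.get j : ℝ) = β * y j - y (j + 1) := by
    intro j
    rw [ys, Int.fract]
    change ((⌊β * y j⌋ : ℤ) : ℝ) = _
    ring
  let w : PointedWord ℤ :=
    { int := d.take m
      int_ne_nil := by
        intro h
        have := congrArg List.length h
        simp [m] at this
      frac := d.drop m }
  have hlen : w.int.length = m := by simp [w]
  have hdig : w.digits = d := Stream'.append_take_drop m d
  have htail : ∀ j, w.tailVal β j = β ^ ((m : ℤ) - j) * y j := by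
    intro j
    unfold PointedWord.tailVal
    rw [hlen, hdig]
    have hpart : ∀ N : ℕ, ∑ i ∈ Finset.range N,
        (d.get (j + i) : ℝ) * β ^ ((m : ℤ) - 1 - ((j + i : ℕ) : ℤ)) =
        β ^ ((m : ℤ) - j) * y j - β ^ ((m : ℤ) - j) * ((β⁻¹) ^ N * y (j + N)) := by
      intro N
      induction N with
      | zero => simp
      | succ N ih =>
        rw [Finset.sum_range_succ, ih, dd]
        have e : β ^ ((m : ℤ) - 1 - ((j + N : ℕ) : ℤ)) =
            β ^ ((m : ℤ) - j) * (β⁻¹) ^ N * β⁻¹ := by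
          rw [mul_assoc, ← pow_succ, inv_pow, ← zpow_natCast, ← zpow_neg, ← zpow_add₀ h0.ne']
          congr 1
          push_cast
          ring
        rw [e, pow_succ, ← Nat.add_assoc]
        field_simp
        ring
    have hnn : ∀ i : ℕ,
        0 ≤ (d.get (j + i) : ℝ) * β ^ ((m : ℤ) - 1 - ((j + i : ℕ) : ℤ)) := by
      intro i
      have : (0 : ℤ) ≤ d.get (j + i) :=
        Int.floor_nonneg.2 (mul_nonneg h0.le (y01 (j + i)).1)
      have : (0 : ℝ) ≤ (d.get (j + i) : ℝ) := by exact_mod_cast this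
      positivity
    refine ((hasSum_iff_tendsto_nat_of_nonneg hnn _).2 ?_).tsum_eq
    simp_rw [hpart]
    have hz : Filter.Tendsto (fun N : ℕ => (β⁻¹) ^ N * y (j + N)) Filter.atTop (nhds 0) := by
      refine squeeze_zero (fun N => mul_nonneg (by positivity) (y01 _).1) (fun N => ?_)
        (tendsto_pow_atTop_nhds_zero_of_lt_one (r := β⁻¹) (by positivity)
          (inv_lt_one_of_one_lt₀ hβ))
      have : 0 ≤ (β⁻¹) ^ N := by positivity
      nlinarith [(y01 (j + N)).2]
    simpa using (hz.const_mul (β ^ ((m : ℤ) - j))).const_sub (β ^ ((m : ℤ) - j) * y j)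
  refine ⟨w, ?_, ?_, ?_⟩
  · rw [PointedWord.val, htail]
    change β ^ ((m : ℤ) - ((0 : ℕ) : ℤ)) * (x / β ^ m) = x
    rw [Nat.cast_zero, sub_zero, zpow_natCast]
    field_simp
  · intro j
    rw [hdig]
    refine Finset.mem_Icc.2 ⟨Int.floor_nonneg.2 (mul_nonneg h0.le (y01 j).1), ?_⟩
    have h1 : β * y j < ⌈β⌉ := by
      have := Int.le_ceil β
      nlinarith [(y01 j).2]
    have h2 : d.get j < ⌈β⌉ := Int.floor_lt.2 h1
    omega
  · intro j
    rw [htail, hlen]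
    have : 0 < β ^ ((m : ℤ) - j) := by positivity
    nlinarith [(y01 j).2]

/-- Every real number has exactly one `β`-expansion. -/
theorem existsUnique_isExpansion {β : ℝ} (hβ : 1 < β) (x : ℝ) :
    ∃! w, IsExpansion β x w := by
  have main : ∀ x : ℝ, 0 ≤ x → ∃! w, IsNonnegExpansion β x w := by
    intro x hx
    classical
    have hex : ∃ n, ∃ w, IsGreedyRep β x w ∧ w.int.length = n := by
      obtain ⟨w, hw⟩ := exists_isGreedyRep hβ hx
      exact ⟨_, w, hw, rfl⟩
    obtain ⟨w, hw, hl⟩ := Nat.find_spec hex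
    refine ⟨w, ⟨hw, fun w' hw' => ?_⟩, fun w' hw' => ?_⟩
    · rw [hl]
      exact Nat.find_min' hex ⟨w', hw', rfl⟩
    · refine hw'.1.unique hβ hw (le_antisymm (hw'.2 w hw) ?_)
      rw [hl]
      exact Nat.find_min' hex ⟨w', hw'.1, rfl⟩
  rcases le_or_gt 0 x with hx | hx
  · obtain ⟨w, hw, hu⟩ := main x hx
    refine ⟨w, Or.inl ⟨hx, hw⟩, ?_⟩
    rintro w' (⟨-, h⟩ | ⟨h, -⟩)
    · exact hu _ h
    · exact absurd hx (not_le.2 h)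
  · obtain ⟨w, hw, hu⟩ := main (-x) (by linarith)
    refine ⟨w.map fun a => -a, Or.inr ⟨hx, ?_⟩, ?_⟩
    · rw [PointedWord.map_neg_map_neg]
      exact hw
    · rintro w' (⟨h, -⟩ | ⟨-, h⟩)
      · exact absurd h (not_le.2 hx)
      · rw [← hu _ h, PointedWord.map_neg_map_neg]

/-- The `β`-expansion `d_β(x)` of a real number `x`. -/
noncomputable def betaExpansion (β : ℝ) (hβ : 1 < β) (x : ℝ) : PointedWord ℤ :=
  (existsUnique_isExpansion hβ x).choose

/-- A (non-deterministic) letter-to-letter transducer with an initial function: `Q` is the set of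
states, edges are labeled by pairs in `A × B`, `init` is a partial function from `Q` to
`A* × B*`, and `terminal` is the set of terminal states. -/
structure LetterTransducer (Q A B : Type) where
  edges : Set (Q × (A × B) × Q)
  init : Q → Option (List A × List B)
  terminal : Set Q

/-- The relation realized by the transducer: `(u, v) = α(q) (u', v')` for some state `q` in the
domain of the initial function `α` and some pair `(u', v')` labeling an infinite path that starts
in `q` and visits terminal states infinitely often (Büchi condition). -/
def LetterTransducer.Accepts {Q A B : Type} (T : LetterTransducer Q A B)
    (u : Stream' A) (v : Stream' B) : Prop :=
  ∃ (q : ℕ → Q) (a : List A) (b : List B) (u' : Stream' A) (v' : Stream' B),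
    T.init (q 0) = some (a, b) ∧ u = a ++ₛ u' ∧ v = b ++ₛ v' ∧
      (∀ n, (q n, (u'.get n, v'.get n), q (n + 1)) ∈ T.edges) ∧
      ∃ᶠ n in Filter.atTop, q n ∈ T.terminal

/-! The input is padded with a fixed number `K` of zeros, and a candidate output of exactly that
total length is compared with it digit by digit. If `c` and `d` are the two digit streams, the
remainders `s ↦ β s + c - d`, started at 0, stay bounded exactly when the values agree
(`abs_remainder_le`, `fracVal_eq_of_remainder_le`).

Greediness says that every tail, rescaled, is less than 1. The tightest constraint still pending on
the tail is a threshold `r`, started at 1 and updated by `r ↦ min 1 (β r - d)`. Thresholds that stay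
bounded only give the weak inequality for the tails. Strictness is detected by the Büchi condition:
infinitely often the old constraint becomes strictly weaker than the new bound 1
(`frequently_one_lt_threshold`, `fracVal_lt_one_of_threshold`).

The Pisot property makes the automaton finite. Remainders and thresholds are algebraic integers of
`ℚ(β)`, bounded at the inclusion, and the update contracts at every other embedding, so only
finitely many values occur (`IsPisot.exists_finite_states`).

The transducer guesses the sign of the value and the first `K` output digits, then runs this
automaton, copying `⋆` without changing state. `K` is chosen so that every expansion fits into the
available length. At that fixed length the signed greedy word is unique (`IsSignedGreedyRep.unique`)
and is the expansion padded with zeros (`exists_isSignedGreedyRep`). `normalizer_sound` and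
`normalizer_complete` identify the accepted outputs with these words. -/

/-- The value `∑_{i ≥ 0} d_i β^{-(i+1)}` of the stream of integer digits `d`. -/
noncomputable def fracVal (β : ℝ) (d : Stream' ℤ) : ℝ := ∑' i : ℕ, (d.get i : ℝ) * β⁻¹ ^ (i + 1)

/-! ### Values of digit streams, remainders and greedy thresholds -/

section fracVal

variable {β M : ℝ} {c d : Stream' ℤ}

theorem summable_inv_pow_succ_mul (hβ : 1 < β) : Summable fun i : ℕ => M * β⁻¹ ^ (i + 1) := by
  have h0 : 0 < β := by linarith
  simp_rw [pow_succ', ← mul_assoc]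
  exact (summable_geometric_of_lt_one (by positivity) (inv_lt_one_of_one_lt₀ hβ)).mul_left _

theorem abs_digit_mul_le (hβ : 1 < β) (hd : ∀ i, |(d.get i : ℝ)| ≤ M) (i : ℕ) :
    ‖(d.get i : ℝ) * β⁻¹ ^ (i + 1)‖ ≤ M * β⁻¹ ^ (i + 1) := by
  have h0 : 0 < β := by linarith
  have h1 : 0 < β⁻¹ ^ (i + 1) := by positivity
  rw [Real.norm_eq_abs, abs_mul, abs_of_pos h1]
  exact mul_le_mul_of_nonneg_right (hd i) h1.le

theorem summable_fracVal (hβ : 1 < β) (hd : ∀ i, |(d.get i : ℝ)| ≤ M) :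
    Summable fun i : ℕ => (d.get i : ℝ) * β⁻¹ ^ (i + 1) :=
  Summable.of_norm_bounded (summable_inv_pow_succ_mul hβ) (abs_digit_mul_le hβ hd)

theorem abs_fracVal_le (hβ : 1 < β) (hd : ∀ i, |(d.get i : ℝ)| ≤ M) :
    |fracVal β d| ≤ M / (β - 1) := by
  have h0 : 0 < β := by linarith
  have h1 : 0 < β - 1 := by linarith
  have h : ‖fracVal β d‖ ≤ ∑' i : ℕ, M * β⁻¹ ^ (i + 1) :=
    tsum_of_norm_bounded (summable_inv_pow_succ_mul hβ).hasSum (abs_digit_mul_le hβ hd)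
  refine h.trans_eq ?_
  simp_rw [pow_succ', ← mul_assoc]
  rw [tsum_mul_left, tsum_geometric_of_lt_one (by positivity) (inv_lt_one_of_one_lt₀ hβ)]
  field_simp

theorem fracVal_nonneg (hβ : 1 < β) (hd : ∀ i, 0 ≤ d.get i) : 0 ≤ fracVal β d := by
  refine tsum_nonneg fun i => ?_
  have : (0 : ℝ) ≤ (d.get i : ℝ) := by exact_mod_cast hd i
  have h0 : 0 < β := by linarith
  positivity

theorem mul_fracVal (hβ : 1 < β) (hd : ∀ i, |(d.get i : ℝ)| ≤ M) :
    β * fracVal β d = d.get 0 + fracVal β (d.drop 1) := by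
  have h0 : 0 < β := by linarith
  rw [fracVal, (summable_fracVal hβ hd).tsum_eq_zero_add, mul_add, ← tsum_mul_left]
  congr 1
  · rw [zero_add, pow_one]
    field_simp
  · refine tsum_congr fun i => ?_
    rw [Stream'.get_drop, Nat.add_comm 1 i, pow_succ]
    field_simp

theorem mul_fracVal_drop (hβ : 1 < β) (hd : ∀ i, |(d.get i : ℝ)| ≤ M) (j : ℕ) :
    β * fracVal β (d.drop j) = d.get j + fracVal β (d.drop (j + 1)) := by
  rw [mul_fracVal (d := d.drop j) (M := M) hβ fun i => by rw [Stream'.get_drop]; exact hd _,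
    Stream'.get_drop, Stream'.drop_drop, Nat.add_zero]

theorem fracVal_map_mul (n : ℤ) : fracVal β (d.map fun a => n * a) = n * fracVal β d := by
  rw [fracVal, fracVal, ← tsum_mul_left]
  refine tsum_congr fun i => ?_
  rw [Stream'.get_map]
  push_cast
  ring

/-- A real number all of whose products with the powers of `β > 1` are bounded is not positive. -/
theorem nonpos_of_pow_mul_le {x B : ℝ} (hβ : 1 < β) (h : ∀ n : ℕ, β ^ n * x ≤ B) : x ≤ 0 := by
  by_contra! hx
  obtain ⟨n, hn⟩ := pow_unbounded_of_one_lt (B / x) hβ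
  rw [div_lt_iff₀ hx] at hn
  exact absurd (h n) (not_le.2 hn)

/-- The remainders of the digitwise difference of two words. -/
theorem remainder_eq (hβ : 1 < β) (hc : ∀ i, |(c.get i : ℝ)| ≤ M) (hd : ∀ i, |(d.get i : ℝ)| ≤ M)
    {s : ℕ → ℝ} (h0 : s 0 = 0) (hs : ∀ j, s (j + 1) = β * s j + (c.get j - d.get j : ℤ)) (j : ℕ) :
    s j + (fracVal β (c.drop j) - fracVal β (d.drop j)) = β ^ j * (fracVal β c - fracVal β d) := by
  induction j with
  | zero => simp [h0]
  | succ j ih =>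
    have h1 := mul_fracVal_drop hβ hc j
    have h2 := mul_fracVal_drop hβ hd j
    rw [hs, pow_succ', mul_assoc, ← ih]
    push_cast
    linarith

/-- When the values agree, `remainder_eq` makes each remainder the difference of two tails, and each
tail is at most `M / (β - 1)` in modulus. -/
theorem abs_remainder_le (hβ : 1 < β) (hc : ∀ i, |(c.get i : ℝ)| ≤ M)
    (hd : ∀ i, |(d.get i : ℝ)| ≤ M) {s : ℕ → ℝ} (h0 : s 0 = 0)
    (hs : ∀ j, s (j + 1) = β * s j + (c.get j - d.get j : ℤ))
    (h : fracVal β c = fracVal β d) (j : ℕ) : |s j| ≤ 2 * (M / (β - 1)) := by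
  have h1 := remainder_eq hβ hc hd h0 hs j
  rw [h, sub_self, mul_zero] at h1
  have h2 := abs_fracVal_le (d := c.drop j) (M := M) hβ fun i => by
    rw [Stream'.get_drop]; exact hc _
  have h3 := abs_fracVal_le (d := d.drop j) (M := M) hβ fun i => by
    rw [Stream'.get_drop]; exact hd _
  rw [abs_le] at *
  constructor <;> linarith

/-- The difference of the values, multiplied by `β ^ j`, is a remainder plus a difference of tails.
It stays bounded as `j` grows, which forces the difference to vanish. -/
theorem fracVal_eq_of_remainder_le (hβ : 1 < β) (hc : ∀ i, |(c.get i : ℝ)| ≤ M)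
    (hd : ∀ i, |(d.get i : ℝ)| ≤ M) {s : ℕ → ℝ} (h0 : s 0 = 0)
    (hs : ∀ j, s (j + 1) = β * s j + (c.get j - d.get j : ℤ))
    {B : ℝ} (hB : ∀ j, |s j| ≤ B) : fracVal β c = fracVal β d := by
  have key : ∀ j : ℕ, |β ^ j * (fracVal β c - fracVal β d)| ≤ B + 2 * (M / (β - 1)) := by
    intro j
    rw [← remainder_eq hβ hc hd h0 hs j]
    have h2 := abs_fracVal_le (d := c.drop j) (M := M) hβ fun i => by
      rw [Stream'.get_drop]; exact hc _
    have h3 := abs_fracVal_le (d := d.drop j) (M := M) hβ fun i => by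
      rw [Stream'.get_drop]; exact hd _
    have h4 := hB j
    rw [abs_le] at *
    constructor <;> linarith
  have h1 : fracVal β c - fracVal β d ≤ 0 :=
    nonpos_of_pow_mul_le hβ fun n => (abs_le.1 (key n)).2
  have h2 : -(fracVal β c - fracVal β d) ≤ 0 :=
    nonpos_of_pow_mul_le hβ fun n => by
      rw [mul_neg]
      exact neg_le.1 (abs_le.1 (key n)).1
  linarith

/-- A word with all tails smaller than `1` stays strictly below the thresholds `r`. -/
theorem fracVal_lt_threshold (hβ : 1 < β) (hd : ∀ i, |(d.get i : ℝ)| ≤ M)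
    {r : ℕ → ℝ} (h0 : r 0 = 1) (hr : ∀ j, r (j + 1) = min 1 (β * r j - d.get j))
    (h : ∀ j, fracVal β (d.drop j) < 1) (j : ℕ) : fracVal β (d.drop j) < r j := by
  induction j with
  | zero => rw [h0]; exact h 0
  | succ j ih =>
    rw [hr, lt_min_iff]
    refine ⟨h _, ?_⟩
    have := mul_fracVal_drop hβ hd j
    nlinarith

theorem threshold_le_one {r : ℕ → ℝ} (h0 : r 0 = 1)
    (hr : ∀ j, r (j + 1) = min 1 (β * r j - d.get j)) (j : ℕ) : r j ≤ 1 := by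
  cases j with
  | zero => exact h0.le
  | succ j => rw [hr]; exact min_le_left _ _

/-- If the minimum were eventually never cut off strictly by 1, the gap between threshold and tail
would from then on be multiplied by exactly `β` at each step. The gap is at most 1, so it could not
be positive, contrary to `fracVal_lt_threshold`. -/
theorem frequently_one_lt_threshold (hβ : 1 < β) (hd : ∀ i, |(d.get i : ℝ)| ≤ M)
    (hn : ∀ i, 0 ≤ d.get i) {r : ℕ → ℝ} (h0 : r 0 = 1)
    (hr : ∀ j, r (j + 1) = min 1 (β * r j - d.get j))
    (h : ∀ j, fracVal β (d.drop j) < 1) : ∃ᶠ j in Filter.atTop, 1 < β * r j - d.get j := by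
  intro hev
  obtain ⟨j, hj⟩ := Filter.eventually_atTop.1 hev
  have he : ∀ n : ℕ, r (j + n) - fracVal β (d.drop (j + n)) =
      β ^ n * (r j - fracVal β (d.drop j)) := by
    intro n
    induction n with
    | zero => simp
    | succ n ih =>
      have h1 := mul_fracVal_drop hβ hd (j + n)
      have h2 := hr (j + n)
      rw [min_eq_right (not_lt.1 (hj (j + n) (by omega)))] at h2
      rw [← Nat.add_assoc, h2, pow_succ', mul_assoc, ← ih]
      linarith
  have h1 : r j - fracVal β (d.drop j) ≤ 0 := by
    refine nonpos_of_pow_mul_le (B := 1) hβ fun n => ?_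
    rw [← he n]
    have h1 := threshold_le_one h0 hr (j + n)
    have h2 : 0 ≤ fracVal β (d.drop (j + n)) := fracVal_nonneg hβ fun i => by
      rw [Stream'.get_drop]; exact hn _
    linarith
  linarith [fracVal_lt_threshold hβ hd h0 hr h j]

/-- The gap between threshold and tail grows at most by the factor `β` per step, so a negative gap
would diverge. Hence all gaps are nonnegative. Just before a strict cut-off the gap is positive, and
positivity passes back to every earlier index. -/
theorem fracVal_lt_one_of_threshold (hβ : 1 < β) (hd : ∀ i, |(d.get i : ℝ)| ≤ M)
    {r : ℕ → ℝ} (h0 : r 0 = 1) (hr : ∀ j, r (j + 1) = min 1 (β * r j - d.get j))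
    {B : ℝ} (hB : ∀ j, |r j| ≤ B) (hf : ∃ᶠ j in Filter.atTop, 1 < β * r j - d.get j) (j : ℕ) :
    fracVal β (d.drop j) < 1 := by
  have hstep : ∀ j, r (j + 1) - fracVal β (d.drop (j + 1)) ≤
      β * (r j - fracVal β (d.drop j)) := by
    intro j
    have h1 := mul_fracVal_drop hβ hd j
    have h2 : r (j + 1) ≤ β * r j - d.get j := by rw [hr]; exact min_le_right _ _
    linarith
  have hsteps : ∀ j n, r (j + n) - fracVal β (d.drop (j + n)) ≤
      β ^ n * (r j - fracVal β (d.drop j)) := by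
    intro j n
    induction n with
    | zero => simp
    | succ n ih =>
      refine (hstep (j + n)).trans ?_
      rw [pow_succ', mul_assoc]
      exact mul_le_mul_of_nonneg_left ih (by linarith)
  have hnn : ∀ j, 0 ≤ r j - fracVal β (d.drop j) := by
    intro j
    have : -(r j - fracVal β (d.drop j)) ≤ 0 := by
      refine nonpos_of_pow_mul_le (B := B + M / (β - 1)) hβ fun n => ?_
      have h1 := hsteps j n
      have h2 := abs_fracVal_le (d := d.drop (j + n)) (M := M) hβ fun i => by
        rw [Stream'.get_drop]; exact hd _
      have h3 := hB (j + n)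
      rw [abs_le] at h2 h3
      rw [mul_neg]
      linarith
    linarith
  obtain ⟨k, hk, hk1⟩ := Filter.frequently_atTop.1 hf j
  obtain ⟨n, rfl⟩ := Nat.exists_eq_add_of_le hk
  have h1 : 0 < β * (r (j + n) - fracVal β (d.drop (j + n))) := by
    have h1 := mul_fracVal_drop hβ hd (j + n)
    have h2 := hnn (j + n + 1)
    have h3 := threshold_le_one h0 hr (j + n + 1)
    linarith
  have h2 : 0 < β ^ n * (r j - fracVal β (d.drop j)) :=
    (pos_of_mul_pos_right h1 (by linarith)).trans_le (hsteps j n)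
  have h3 : 0 < r j - fracVal β (d.drop j) := pos_of_mul_pos_right h2 (by positivity)
  linarith [threshold_le_one h0 hr j]

end fracVal

/-! ### Finiteness from the Pisot property -/

open IntermediateField in
/-- If `β` is a Pisot number, then there are only finitely many values that can occur in a bounded
sequence whose terms are `0`, `1` or `β` times the preceding term plus an integer bounded by `D`. -/
theorem IsPisot.exists_finite_states {β : ℝ} (hβ : IsPisot β) (D : ℝ) :
    ∃ F : Set ℝ, F.Finite ∧ ∀ x : ℕ → ℝ, (x 0 = 0 ∨ x 0 = 1) →
      (∀ j, x (j + 1) = 1 ∨ ∃ d : ℤ, |(d : ℝ)| ≤ D ∧ x (j + 1) = β * x j + d) →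
      (∀ j, |x j| ≤ D) → ∀ j, x j ∈ F := by
  have hQ : IsIntegral ℚ β := hβ.isIntegral.tower_top
  let K := ℚ⟮β⟯
  have : FiniteDimensional ℚ K := adjoin.finiteDimensional hQ
  have : NumberField K := ⟨⟩
  let γ : K := AdjoinSimple.gen ℚ β
  have hγ : algebraMap K ℝ γ = β := AdjoinSimple.algebraMap_gen ℚ β
  have hγi : IsIntegral ℤ γ := by
    rw [← isIntegral_algebraMap_iff (algebraMap K ℝ).injective, hγ]
    exact hβ.isIntegral
  -- An embedding of `ℚ(β)` is determined by the image of the generator, so this one is the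
  -- inclusion.
  have hstd : ∀ φ : K →+* ℂ, φ γ = β → ∀ y : K, φ y = (algebraMap K ℝ y : ℂ) := by
    intro φ hφ y
    have h : φ.toRatAlgHom = (Complex.ofRealAm.restrictScalars ℚ).comp
        (IsScalarTower.toAlgHom ℚ K ℝ) := by
      refine adjoin_algHom_ext ℚ fun z hz => ?_
      obtain rfl : z = β := hz
      exact hφ
    exact DFunLike.congr_fun h y
  have hother : ∀ φ : K →+* ℂ, φ γ ≠ β → ‖φ γ‖ < 1 := by
    intro φ hφ
    refine hβ.conj_lt _ ?_ hφ
    have h : Polynomial.aeval γ (minpoly ℚ β) = 0 := by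
      refine (algebraMap K ℝ).injective ?_
      rw [← Polynomial.aeval_algebraMap_apply, hγ, minpoly.aeval, map_zero]
    have := Polynomial.aeval_algHom_apply φ.toRatAlgHom γ (minpoly ℚ β)
    rw [h, map_zero] at this
    exact this
  obtain ⟨ρ, hρ0, hρ1, hρ⟩ : ∃ ρ : ℝ, 0 ≤ ρ ∧ ρ < 1 ∧ ∀ φ : K →+* ℂ, φ γ ≠ β → ‖φ γ‖ ≤ ρ := by
    have : ∀ S : Finset (K →+* ℂ), (∀ φ ∈ S, φ γ ≠ β) →
        ∃ ρ : ℝ, 0 ≤ ρ ∧ ρ < 1 ∧ ∀ φ ∈ S, ‖φ γ‖ ≤ ρ := by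
      intro S
      classical
      induction S using Finset.induction_on with
      | empty => exact fun _ => ⟨0, le_rfl, one_pos, by simp⟩
      | insert φ S _ ih =>
        intro h
        obtain ⟨ρ, h0, h1, h2⟩ := ih fun ψ hψ => h ψ (Finset.mem_insert_of_mem hψ)
        refine ⟨max ρ ‖φ γ‖, h0.trans (le_max_left _ _),
          max_lt h1 (hother φ (h φ (Finset.mem_insert_self _ _))), fun ψ hψ => ?_⟩
        rcases Finset.mem_insert.1 hψ with rfl | hψ
        · exact le_max_right _ _
        · exact (h2 ψ hψ).trans (le_max_left _ _)
    classical
    obtain ⟨ρ, h0, h1, h2⟩ := this (Finset.univ.filter fun φ => φ γ ≠ β) (by simp)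
    exact ⟨ρ, h0, h1, fun φ hφ => h2 φ (by simpa using hφ)⟩
  have hρ' : 0 < 1 - ρ := by linarith
  -- `B` dominates the given bound `D` and the restart value 1, and the ball of radius `B` is stable
  -- under multiplication by a number of modulus at most `ρ` followed by a translation by at most
  -- `D`.
  let B : ℝ := max D (max 1 (D / (1 - ρ)))
  have hB1 : 1 ≤ B := (le_max_left _ _).trans (le_max_right _ _)
  have hBD : D ≤ B := le_max_left _ _
  have hBρ : ρ * B + D ≤ B := by
    have : D / (1 - ρ) ≤ B := (le_max_right _ _).trans (le_max_right _ _)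
    rw [div_le_iff₀ hρ'] at this
    linarith
  refine ⟨algebraMap K ℝ '' {y : K | IsIntegral ℤ y ∧ ∀ φ : K →+* ℂ, ‖φ y‖ ≤ B},
    (NumberField.Embeddings.finite_of_norm_le K ℂ B).image _, fun x h0 hs hx j => ?_⟩
  -- The induction controls only the contracting embeddings. At the inclusion, where the step
  -- expands, the bound is the hypothesis on `x j` itself.
  suffices h : ∃ y : K, algebraMap K ℝ y = x j ∧ IsIntegral ℤ y ∧
      ∀ φ : K →+* ℂ, φ γ ≠ β → ‖φ y‖ ≤ B by
    obtain ⟨y, hy, hi, hφ⟩ := h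
    refine ⟨y, ⟨hi, fun φ => ?_⟩, hy⟩
    by_cases h : φ γ = β
    · rw [hstd φ h, hy, Complex.norm_real]
      exact (hx j).trans hBD
    · exact hφ φ h
  induction j with
  | zero =>
    rcases h0 with h0 | h0
    · exact ⟨0, by simp [h0], isIntegral_zero, fun φ _ => by rw [map_zero, norm_zero]; linarith⟩
    · exact ⟨1, by simp [h0], isIntegral_one, fun φ _ => by rw [map_one, norm_one]; exact hB1⟩
  | succ j ih =>
    rcases hs j with h1 | ⟨d, hd, h1⟩
    · exact ⟨1, by simp [h1], isIntegral_one, fun φ _ => by rw [map_one, norm_one]; exact hB1⟩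
    · obtain ⟨y, hy, hi, hφ⟩ := ih
      refine ⟨γ * y + d, ?_, (hγi.mul hi).add (isIntegral_algebraMap (R := ℤ) (x := d)), ?_⟩
      · rw [map_add, map_mul, hγ, hy, h1, map_intCast]
      · intro φ h
        rw [map_add, map_mul, map_intCast]
        refine (norm_add_le _ _).trans (le_trans (add_le_add ?_ ?_) hBρ)
        · rw [norm_mul]
          exact mul_le_mul (hρ φ h) (hφ φ h) (norm_nonneg _) hρ0
        · rw [Complex.norm_intCast]
          exact hd

/-! ### Leading zeros and the rescaled greedy condition -/

namespace PointedWord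

variable {D D' : Type}

/-- The word `l w` for a finite word `l`. -/
def prepend (l : List D) (w : PointedWord D) : PointedWord D where
  int := l ++ w.int
  int_ne_nil := by simp [w.int_ne_nil]
  frac := w.frac

theorem digits_prepend (l : List D) (w : PointedWord D) :
    (w.prepend l).digits = l ++ₛ w.digits := by
  simp [prepend, digits]

theorem toStream_prepend (l : List D) (w : PointedWord D) :
    (w.prepend l).toStream = l.map some ++ₛ w.toStream := by
  simp [prepend, toStream]

theorem length_prepend (l : List D) (w : PointedWord D) :
    (w.prepend l).int.length = l.length + w.int.length := by
  simp [prepend]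

theorem prepend_append (l l' : List D) (w : PointedWord D) :
    w.prepend (l ++ l') = (w.prepend l').prepend l := by
  simp [prepend]

theorem map_prepend (f : D → D') (l : List D) (w : PointedWord D) :
    (w.prepend l).map f = (w.map f).prepend (l.map f) := by
  simp [prepend, map]

theorem digits_map (f : D → D') (w : PointedWord D) : (w.map f).digits = w.digits.map f := by
  simp [map, digits, Stream'.map_append_stream]

theorem toStream_map (f : D → D') (w : PointedWord D) :
    (w.map f).toStream = w.toStream.map (Option.map f) := by
  simp [map, toStream, Stream'.map_append_stream, Stream'.map_cons, Stream'.map_map,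
    Function.comp_def]

theorem length_map (f : D → D') (w : PointedWord D) :
    (w.map f).int.length = w.int.length := by
  simp [map]

theorem tailVal_eq {β : ℝ} (h0 : 0 < β) (w : PointedWord ℤ) (j : ℕ) :
    w.tailVal β j = β ^ ((w.int.length : ℤ) - j) * fracVal β (w.digits.drop j) := by
  rw [tailVal, fracVal, ← tsum_mul_left]
  refine tsum_congr fun i => ?_
  rw [Stream'.get_drop, inv_pow, ← zpow_natCast, ← zpow_neg, mul_left_comm, ← zpow_add₀ h0.ne']
  congr 2
  push_cast
  ring

theorem val_eq {β : ℝ} (h0 : 0 < β) (w : PointedWord ℤ) :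
    w.val β = β ^ w.int.length * fracVal β w.digits := by
  rw [val, tailVal_eq h0, Nat.cast_zero, sub_zero, zpow_natCast, Stream'.drop_zero]

end PointedWord

theorem abs_le_of_mem_canonicalAlphabet {β : ℝ} {a : ℤ} (h : a ∈ canonicalAlphabet β) :
    |(a : ℝ)| ≤ ⌈β⌉ := by
  obtain ⟨h1, h2⟩ := Finset.mem_Icc.1 h
  rw [← Int.cast_abs, abs_of_nonneg h1]
  exact_mod_cast h2.trans (by omega)

theorem zero_mem_canonicalAlphabet {β : ℝ} (hβ : 1 < β) : 0 ∈ canonicalAlphabet β := by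
  have : 0 < ⌈β⌉ := Int.ceil_pos.2 (by linarith)
  exact Finset.mem_Icc.2 ⟨le_rfl, by omega⟩

/-- Dividing each tail condition by its power of `β` removes the dependence on the position, so an
automaton can test it. -/
theorem isGreedyRep_iff {β : ℝ} (hβ : 1 < β) {x : ℝ} {w : PointedWord ℤ} :
    IsGreedyRep β x w ↔ β ^ w.int.length * fracVal β w.digits = x ∧
      (∀ j, w.digits.get j ∈ canonicalAlphabet β) ∧ ∀ j, fracVal β (w.digits.drop j) < 1 := by
  have h0 : 0 < β := by linarith
  have h (j : ℕ) : w.tailVal β j < β ^ ((w.int.length : ℤ) - j) ↔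
      fracVal β (w.digits.drop j) < 1 := by
    rw [PointedWord.tailVal_eq h0]
    exact mul_lt_iff_lt_one_right (by positivity)
  rw [← PointedWord.val_eq h0]
  exact ⟨fun ⟨h1, h2, h3⟩ => ⟨h1, h2, fun j => (h j).1 (h3 j)⟩,
    fun ⟨h1, h2, h3⟩ => ⟨h1, h2, fun j => (h j).2 (h3 j)⟩⟩

theorem mul_fracVal_cons_zero {β M : ℝ} (hβ : 1 < β) {d : Stream' ℤ}
    (hd : ∀ i, |(d.get i : ℝ)| ≤ M) : β * fracVal β (0 :: d) = fracVal β d := by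
  rw [mul_fracVal (M := M) hβ]
  · rw [Stream'.get_zero_cons, Int.cast_zero, zero_add]
    rfl
  · rintro (_ | i)
    · simpa using (abs_nonneg _).trans (hd 0)
    · exact hd i

theorem pow_mul_fracVal_replicate {β M : ℝ} (hβ : 1 < β) {d : Stream' ℤ}
    (hd : ∀ i, |(d.get i : ℝ)| ≤ M) (m : ℕ) :
    β ^ m * fracVal β (List.replicate m 0 ++ₛ d) = fracVal β d := by
  have hb : ∀ m i, |((List.replicate m 0 ++ₛ d).get i : ℝ)| ≤ M := by
    intro m
    induction m with
    | zero => exact hd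
    | succ m ih =>
      rintro (_ | i)
      · simpa [List.replicate_succ, Stream'.cons_append_stream] using (abs_nonneg _).trans (hd 0)
      · exact ih i
  induction m with
  | zero => simp
  | succ m ih =>
    rw [List.replicate_succ, Stream'.cons_append_stream, pow_succ, mul_assoc,
      mul_fracVal_cons_zero hβ (hb m), ih]

/-- The only new condition concerns the whole word, whose rescaled value is that of the old word
divided by `β`. -/
theorem isGreedyRep_prepend_zero {β : ℝ} (hβ : 1 < β) {x : ℝ} {w : PointedWord ℤ} :
    IsGreedyRep β x (w.prepend [0]) ↔ IsGreedyRep β x w := by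
  rw [isGreedyRep_iff hβ, isGreedyRep_iff hβ, PointedWord.digits_prepend,
    PointedWord.length_prepend, Stream'.cons_append_stream, Stream'.nil_append_stream,
    List.length_singleton, add_comm 1]
  have hA : (∀ j, (0 :: w.digits).get j ∈ canonicalAlphabet β) ↔
      ∀ j, w.digits.get j ∈ canonicalAlphabet β :=
    ⟨fun h j => h (j + 1), fun h j => by
      rcases j with _ | j
      exacts [zero_mem_canonicalAlphabet hβ, h j]⟩
  rw [hA]
  have hv : (∀ j, w.digits.get j ∈ canonicalAlphabet β) →
      β * fracVal β (0 :: w.digits) = fracVal β w.digits := fun h =>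
    mul_fracVal_cons_zero hβ fun i => abs_le_of_mem_canonicalAlphabet (h i)
  constructor
  · rintro ⟨h1, h2, h3⟩
    rw [pow_succ, mul_assoc, hv h2] at h1
    exact ⟨h1, h2, fun j => h3 (j + 1)⟩
  · rintro ⟨h1, h2, h3⟩
    rw [pow_succ, mul_assoc, hv h2]
    refine ⟨h1, h2, fun j => ?_⟩
    rcases j with _ | j
    · have h4 := hv h2
      have h5 : fracVal β w.digits < 1 := h3 0
      rw [Stream'.drop_zero]
      by_contra! h6
      nlinarith
    · exact h3 j

theorem isGreedyRep_prepend_replicate {β : ℝ} (hβ : 1 < β) {x : ℝ} {w : PointedWord ℤ} (m : ℕ) :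
    IsGreedyRep β x (w.prepend (List.replicate m 0)) ↔ IsGreedyRep β x w := by
  induction m with
  | zero => rfl
  | succ m ih =>
    have : List.replicate (m + 1) (0 : ℤ) = [0] ++ List.replicate m 0 := rfl
    rw [this, PointedWord.prepend_append, isGreedyRep_prepend_zero hβ, ih]

theorem IsGreedyRep.nonneg {β : ℝ} (hβ : 1 < β) {x : ℝ} {w : PointedWord ℤ}
    (h : IsGreedyRep β x w) : 0 ≤ x :=
  h.val_eq ▸ PointedWord.tailVal_nonneg hβ h.mem_alphabet 0

/-- Needed because the sign is ambiguous for the value 0: both guesses must yield the same word. -/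
theorem IsGreedyRep.digit_eq_zero {β : ℝ} (hβ : 1 < β) {w : PointedWord ℤ}
    (h : IsGreedyRep β 0 w) (j : ℕ) : w.digits.get j = 0 := by
  have h0 : 0 < β := by linarith
  have hp : ∀ j : ℕ, 0 < β ^ ((w.int.length : ℤ) - 1 - j) := fun j => by positivity
  have hd : ∀ j : ℕ, (0 : ℝ) ≤ w.digits.get j := fun j => by
    exact_mod_cast (Finset.mem_Icc.1 (h.mem_alphabet j)).1
  have ht := PointedWord.tailVal_nonneg hβ h.mem_alphabet
  have hz : ∀ j, w.tailVal β j = 0 := by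
    intro j
    induction j with
    | zero => exact h.val_eq
    | succ j ih =>
      have := PointedWord.tailVal_succ hβ h.mem_alphabet j
      have := mul_nonneg (hd j) (hp j).le
      linarith [ht (j + 1)]
  have h1 := PointedWord.tailVal_succ hβ h.mem_alphabet j
  rw [hz, hz, add_zero, eq_comm, mul_eq_zero] at h1
  exact_mod_cast h1.resolve_right (hp j).ne'

/-- In a longer expansion, a nonzero leading digit would alone contribute at least `β ^ n`, and a
zero leading digit could be removed, against minimality. -/
theorem IsNonnegExpansion.length_le {β : ℝ} (hβ : 1 < β) {x : ℝ} {w : PointedWord ℤ}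
    (h : IsNonnegExpansion β x w) {n : ℕ} (hn : 1 ≤ n) (hx : x < β ^ n) : w.int.length ≤ n := by
  by_contra! hlt
  have h0 : 0 < β := by linarith
  obtain ⟨a, w', rfl⟩ : ∃ a w', w = PointedWord.prepend [a] w' := by
    obtain ⟨_ | ⟨a, _ | ⟨b, l⟩⟩, hw, f⟩ := w
    · exact absurd rfl hw
    · exact absurd hlt (not_lt.2 hn)
    · exact ⟨a, ⟨b :: l, by simp, f⟩, rfl⟩
  have hlen : (w'.prepend [a]).int.length = w'.int.length + 1 := by
    rw [PointedWord.length_prepend, add_comm]; rfl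
  have hget : (w'.prepend [a]).digits.get 0 = a := by rw [PointedWord.digits_prepend]; rfl
  have ha := Finset.mem_Icc.1 (h.1.mem_alphabet 0)
  obtain rfl : a = 0 := by
    by_contra hne
    have ha1 : (1 : ℝ) ≤ a := by
      rw [hget] at ha
      exact_mod_cast (by omega : 1 ≤ a)
    have h1 := PointedWord.tailVal_succ hβ h.1.mem_alphabet 0
    have h2 := PointedWord.tailVal_nonneg hβ h.1.mem_alphabet 1
    have h3 : (w'.prepend [a]).tailVal β 0 = x := h.1.val_eq
    rw [h3, hget, hlen, Nat.cast_zero, sub_zero, Nat.cast_add, Nat.cast_one, add_sub_cancel_right,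
      zpow_natCast] at h1
    have h4 : β ^ n ≤ β ^ w'.int.length := pow_le_pow_right₀ hβ.le (by omega)
    have h5 : 0 < β ^ w'.int.length := by positivity
    rw [zero_add] at h1
    nlinarith
  have := h.2 w' ((isGreedyRep_prepend_zero hβ).1 h.1)
  omega

/-! ### Signed greedy representations of a prescribed length -/

/-- `w` or its digitwise opposite is a greedy representation of `x`, respectively `-x`. -/
def IsSignedGreedyRep (β x : ℝ) (w : PointedWord ℤ) : Prop :=
  ∃ σ : ℤˣ, IsGreedyRep β ((σ : ℤ) * x) (w.map fun a => (σ : ℤ) * a)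

/-- For nonzero `x` the sign is forced, since greedy words have nonnegative value. For `x = 0` all
digits vanish, whatever the signs. -/
theorem IsSignedGreedyRep.unique {β : ℝ} (hβ : 1 < β) {x : ℝ} {w w' : PointedWord ℤ}
    (h : IsSignedGreedyRep β x w) (h' : IsSignedGreedyRep β x w')
    (hl : w.int.length = w'.int.length) : w = w' := by
  obtain ⟨σ, h⟩ := h
  obtain ⟨τ, h'⟩ := h'
  refine PointedWord.ext_digits hl (Stream'.ext fun j => ?_)
  have hcancel : ∀ (σ : ℤˣ) (a b : ℤ), σ * a = σ * b → a = b := fun σ a b h =>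
    mul_left_cancel₀ σ.ne_zero h
  by_cases hx : x = 0
  · subst hx
    rw [mul_zero] at h h'
    have h1 := h.digit_eq_zero hβ j
    have h2 := h'.digit_eq_zero hβ j
    rw [PointedWord.digits_map, Stream'.get_map] at h1 h2
    exact (hcancel σ _ 0 (by rw [h1, mul_zero])).trans (hcancel τ _ 0 (by rw [h2, mul_zero])).symm
  · obtain rfl : σ = τ := by
      have h1 := h.nonneg hβ
      have h2 := h'.nonneg hβ
      rcases Int.units_eq_one_or σ with rfl | rfl <;> rcases Int.units_eq_one_or τ with rfl | rfl
      · rfl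
      · exact absurd (by push_cast at h1 h2; linarith) hx
      · exact absurd (by push_cast at h1 h2; linarith) hx
      · rfl
    have h1 := h.unique hβ h' (by rw [PointedWord.length_map, PointedWord.length_map, hl])
    have h2 := congrArg (fun w => w.digits.get j) h1
    simp only [PointedWord.digits_map, Stream'.get_map] at h2
    exact hcancel σ _ _ h2

theorem IsSignedGreedyRep.mem_signedAlphabet {β x : ℝ} {w : PointedWord ℤ}
    (h : IsSignedGreedyRep β x w) (j : ℕ) : w.digits.get j ∈ signedAlphabet β := by
  obtain ⟨σ, h⟩ := h
  have h1 := h.mem_alphabet j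
  rw [PointedWord.digits_map, Stream'.get_map] at h1
  rcases Int.units_eq_one_or σ with rfl | rfl
  · exact Finset.mem_union_left _ (by simpa using h1)
  · exact Finset.mem_union_right _ (Finset.mem_image.2 ⟨_, h1, by simp⟩)

theorem exists_isSignedGreedyRep {β : ℝ} (hβ : 1 < β) {x : ℝ} {n : ℕ} (hn : 1 ≤ n)
    (hx : |x| < β ^ n) : ∃ m : ℕ,
      ((betaExpansion β hβ x).prepend (List.replicate m 0)).int.length = n ∧
      IsSignedGreedyRep β x ((betaExpansion β hβ x).prepend (List.replicate m 0)) := by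
  have hw : IsExpansion β x (betaExpansion β hβ x) :=
    (existsUnique_isExpansion hβ x).choose_spec.1
  generalize betaExpansion β hβ x = w at hw
  obtain ⟨σ, hσ⟩ : ∃ σ : ℤˣ, IsNonnegExpansion β ((σ : ℤ) * x) (w.map fun a => (σ : ℤ) * a) := by
    rcases hw with ⟨-, h⟩ | ⟨-, h⟩
    · refine ⟨1, ?_⟩
      have : (w.map fun a => a) = w := by
        refine PointedWord.ext_digits (PointedWord.length_map _ _) ?_
        rw [PointedWord.digits_map, show (fun a : ℤ => a) = id from rfl, Stream'.map_id]
      simpa [this] using h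
    · exact ⟨-1, by simpa using h⟩
  have hlen : w.int.length ≤ n := by
    rw [← PointedWord.length_map fun a : ℤ => (σ : ℤ) * a]
    refine hσ.length_le hβ hn (lt_of_le_of_lt ?_ hx)
    refine (le_abs_self _).trans_eq ?_
    rw [abs_mul, ← Int.cast_abs, Int.isUnit_iff_abs_eq.1 σ.isUnit, Int.cast_one, one_mul]
  refine ⟨n - w.int.length, ?_, σ, ?_⟩
  · rw [PointedWord.length_prepend, List.length_replicate]
    omega
  · rw [PointedWord.map_prepend, List.map_replicate, mul_zero, isGreedyRep_prepend_replicate hβ]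
    exact hσ.1

/-! ### The normalization automaton -/

/-- One step of the normalization automaton, which reads a pair of digits. The state consists of
the remainder of the difference of the two words read so far, of the strict upper bound that the
remaining part of the (signed) second word has to satisfy, and of a mark telling whether this bound
has just been weakened. -/
noncomputable def normStep (β : ℝ) (σ : ℤˣ) (p : ℝ × ℝ × Bool) (e : ℤ × ℤ) : ℝ × ℝ × Bool :=
  (β * p.1 + (e.1 - e.2 : ℤ), min 1 (β * p.2.1 - (σ * e.2 : ℤ)),
    decide (1 < β * p.2.1 - (σ * e.2 : ℤ)))

/-- The state reached after the first `n` pairs of digits. -/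
noncomputable def normRun (β : ℝ) (σ : ℤˣ) (e : Stream' (ℤ × ℤ)) (n : ℕ) : ℝ × ℝ × Bool :=
  (e.take n).foldl (normStep β σ) (0, 1, false)

section normRun

variable {β M : ℝ} {σ : ℤˣ} {e : Stream' (ℤ × ℤ)}

theorem normRun_succ (n : ℕ) :
    normRun β σ e (n + 1) = normStep β σ (normRun β σ e n) (e.get n) := by
  rw [normRun, Stream'.take_succ', List.foldl_append]
  rfl

theorem normRun_remainder_succ (n : ℕ) : (normRun β σ e (n + 1)).1 =
    β * (normRun β σ e n).1 + ((e.map Prod.fst).get n - (e.map Prod.snd).get n : ℤ) := by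
  rw [normRun_succ]
  rfl

theorem normRun_threshold_succ (n : ℕ) : (normRun β σ e (n + 1)).2.1 =
    min 1 (β * (normRun β σ e n).2.1 - ((e.map Prod.snd).map fun a => (σ : ℤ) * a).get n) := by
  rw [normRun_succ]
  rfl

theorem normRun_mark_succ (n : ℕ) : (normRun β σ e (n + 1)).2.2 = true ↔
    1 < β * (normRun β σ e n).2.1 - ((e.map Prod.snd).map fun a => (σ : ℤ) * a).get n := by
  rw [normRun_succ]
  exact decide_eq_true_iff

theorem abs_units_mul (σ : ℤˣ) (a : ℤ) : |((σ * a : ℤ) : ℝ)| = |(a : ℝ)| := by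
  rcases Int.units_eq_one_or σ with rfl | rfl <;> simp

theorem abs_le_of_signed_mem {σ : ℤˣ} {a : ℤ} (h : σ * a ∈ canonicalAlphabet β) :
    |(a : ℝ)| ≤ ⌈β⌉ :=
  abs_units_mul σ a ▸ abs_le_of_mem_canonicalAlphabet h

/-- The mark of a state records the step leading to it, so the two conditions differ by an index
shift of one. -/
theorem frequently_mark_iff : (∃ᶠ n in Filter.atTop, (normRun β σ e n).2.2 = true) ↔
    ∃ᶠ n in Filter.atTop,
      1 < β * (normRun β σ e n).2.1 - ((e.map Prod.snd).map fun a => (σ : ℤ) * a).get n := by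
  simp_rw [← normRun_mark_succ (σ := σ)]
  rw [← Filter.map_add_atTop_eq_nat 1, Filter.frequently_map]
  simp_rw [Filter.map_add_atTop_eq_nat 1]

/-- If the states of a run lie eventually in a finite set and are marked infinitely often, then
the two words have the same value, and the (signed) second word is greedy. -/
theorem normRun_sound (hβ : 1 < β) (hc : ∀ i, |((e.map Prod.fst).get i : ℝ)| ≤ M)
    (hd : ∀ i, |((e.map Prod.snd).get i : ℝ)| ≤ M) {F : Set ℝ} (hF : F.Finite) {K : ℕ}
    (h1 : ∀ n, (normRun β σ e (K + n)).1 ∈ F) (h2 : ∀ n, (normRun β σ e (K + n)).2.1 ∈ F)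
    (hf : ∃ᶠ n in Filter.atTop, (normRun β σ e n).2.2 = true) :
    fracVal β (e.map Prod.fst) = fracVal β (e.map Prod.snd) ∧
      ∀ j, fracVal β (((e.map Prod.snd).map fun a => (σ : ℤ) * a).drop j) < 1 := by
  have hbound : ∀ s : ℕ → ℝ, (∀ n, s (K + n) ∈ F) → ∃ B, ∀ j, |s j| ≤ B := by
    intro s hs
    -- The first `K` states belong to the initial output and need not lie in `F`, but they are
    -- finitely many.
    obtain ⟨B, hB⟩ := (hF.union ((Set.finite_Iio K).image s)).isBounded.exists_norm_le
    refine ⟨B, fun j => hB _ ?_⟩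
    rcases lt_or_ge j K with hj | hj
    · exact Or.inr ⟨j, hj, rfl⟩
    · obtain ⟨n, rfl⟩ := Nat.exists_eq_add_of_le hj
      exact Or.inl (hs n)
  obtain ⟨B1, hB1⟩ := hbound (fun n => (normRun β σ e n).1) h1
  obtain ⟨B2, hB2⟩ := hbound (fun n => (normRun β σ e n).2.1) h2
  refine ⟨fracVal_eq_of_remainder_le hβ hc hd rfl normRun_remainder_succ hB1, ?_⟩
  refine fracVal_lt_one_of_threshold (M := M) hβ (fun i => ?_) rfl normRun_threshold_succ hB2
    (frequently_mark_iff.1 hf)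
  rw [Stream'.get_map, abs_units_mul]
  exact hd i

/-- If two words have the same value and the (signed) second word is greedy, then the run has
bounded states and is marked infinitely often. -/
theorem normRun_complete (hβ : 1 < β) (hc : ∀ i, |((e.map Prod.fst).get i : ℝ)| ≤ M)
    (hd : ∀ i, |((e.map Prod.snd).get i : ℝ)| ≤ M)
    (hA : ∀ i, 0 ≤ ((e.map Prod.snd).map fun a => (σ : ℤ) * a).get i)
    (hv : fracVal β (e.map Prod.fst) = fracVal β (e.map Prod.snd))
    (hg : ∀ j, fracVal β (((e.map Prod.snd).map fun a => (σ : ℤ) * a).drop j) < 1) :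
    (∀ n, |(normRun β σ e n).1| ≤ 2 * (M / (β - 1))) ∧ (∀ n, |(normRun β σ e n).2.1| ≤ 1) ∧
      ∃ᶠ n in Filter.atTop, (normRun β σ e n).2.2 = true := by
  have hd' : ∀ i, |(((e.map Prod.snd).map fun a => (σ : ℤ) * a).get i : ℝ)| ≤ M := fun i => by
    rw [Stream'.get_map, abs_units_mul]
    exact hd i
  refine ⟨abs_remainder_le hβ hc hd rfl normRun_remainder_succ hv, fun n => ?_,
    frequently_mark_iff.2
      (frequently_one_lt_threshold hβ hd' hA rfl normRun_threshold_succ hg)⟩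
  have h1 := fracVal_lt_threshold (r := fun n => (normRun β σ e n).2.1) hβ hd' rfl
    normRun_threshold_succ hg n
  have h2 : 0 ≤ fracVal β (((e.map Prod.snd).map fun a => (σ : ℤ) * a).drop n) :=
    fracVal_nonneg hβ fun i => by rw [Stream'.get_drop]; exact hA _
  rw [abs_of_pos (h2.trans_lt h1)]
  exact threshold_le_one (r := fun n => (normRun β σ e n).2.1) rfl normRun_threshold_succ n

/-- The states of bounded runs on words with bounded digits stay in a finite set. -/
theorem IsPisot.exists_finite_normRun (hβ : IsPisot β) (M : ℝ) :
    ∃ F : Set ℝ, F.Finite ∧ ∀ (σ : ℤˣ) (e : Stream' (ℤ × ℤ)),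
      (∀ i, |((e.map Prod.fst).get i : ℝ)| ≤ M) → (∀ i, |((e.map Prod.snd).get i : ℝ)| ≤ M) →
      (∀ n, |(normRun β σ e n).1| ≤ 2 * (M / (β - 1))) → (∀ n, |(normRun β σ e n).2.1| ≤ 1) →
      ∀ n, (normRun β σ e n).1 ∈ F ∧ (normRun β σ e n).2.1 ∈ F := by
  -- The three terms bound the digit differences, the remainders and the thresholds.
  obtain ⟨F, hF, h⟩ := hβ.exists_finite_states (max (2 * M) (max (2 * (M / (β - 1))) 1))
  refine ⟨F, hF, fun σ e hc hd h1 h2 n => ⟨?_, ?_⟩⟩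
  · refine h (fun n => (normRun β σ e n).1) (Or.inl rfl)
      (fun j => Or.inr ⟨_, ?_, normRun_remainder_succ j⟩)
      (fun j => (h1 j).trans ((le_max_left _ _).trans (le_max_right _ _))) n
    refine le_trans ?_ (le_max_left _ _)
    have h3 := hc j
    have h4 := hd j
    push_cast
    rw [abs_le] at *
    constructor <;> linarith
  · refine h (fun n => (normRun β σ e n).2.1) (Or.inr rfl) (fun j => ?_)
      (fun j => (h2 j).trans ((le_max_right _ _).trans (le_max_right _ _))) n
    simp only [normRun_threshold_succ]
    rcases min_choice 1 (β * (normRun β σ e j).2.1 -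
      ((e.map Prod.snd).map fun a => (σ : ℤ) * a).get j) with h | h
    · exact Or.inl h
    · refine Or.inr ⟨-((e.map Prod.snd).map fun a => (σ : ℤ) * a).get j, ?_, ?_⟩
      · rw [Int.cast_neg, abs_neg, Stream'.get_map, abs_units_mul]
        have h3 := hd j
        exact h3.trans ((by linarith [(abs_nonneg _).trans h3] : M ≤ 2 * M).trans
          (le_max_left _ _))
      · rw [h, Int.cast_neg, sub_eq_add_neg]

end normRun

/-! ### Inserting and erasing the symbol `⋆` -/

namespace PointedWord

variable {D : Type}

/-- The position in `w.toStream` of the `n`-th digit of `w`, where `L` is the number of digits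
before `⋆`. -/
def digitPos (L n : ℕ) : ℕ := if n < L then n else n + 1

/-- The number of digits before the position `n` of `w.toStream`, where `L` is the number of digits
before `⋆`. -/
def digitCount (L n : ℕ) : ℕ := if n ≤ L then n else n - 1

theorem digitPos_of_le {L n : ℕ} (h : L ≤ n) : digitPos L n = n + 1 := if_neg (not_lt.2 h)

theorem eq_or_exists_eq_digitPos (L n : ℕ) : n = L ∨ ∃ m, n = digitPos L m := by
  rcases lt_trichotomy n L with h | h | h
  · exact Or.inr ⟨n, by rw [digitPos, if_pos h]⟩
  · exact Or.inl h
  · exact Or.inr ⟨n - 1, by rw [digitPos, if_neg (by omega)]; omega⟩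

theorem digitCount_digitPos (L n : ℕ) : digitCount L (digitPos L n) = n := by
  unfold digitCount digitPos
  split_ifs <;> omega

theorem digitCount_digitPos_succ (L n : ℕ) : digitCount L (digitPos L n + 1) = n + 1 := by
  unfold digitCount digitPos
  split_ifs <;> omega

theorem toStream_get_length (w : PointedWord D) : w.toStream.get w.int.length = none := by
  have h := Stream'.get_append_length (w.int.map some) (none :: w.frac.map some)
  rw [List.length_map] at h
  exact h

theorem toStream_get_digitPos (w : PointedWord D) (n : ℕ) :
    w.toStream.get (digitPos w.int.length n) = some (w.digits.get n) := by
  rcases lt_or_ge n w.int.length with h | h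
  · rw [digitPos, if_pos h, toStream, Stream'.get_append_left _ _ _ (by simpa using h), digits,
      Stream'.get_append_left _ _ _ h, List.getElem_map]
  · obtain ⟨m, rfl⟩ := Nat.exists_eq_add_of_le h
    have h1 := Stream'.get_append_right (m + 1) (w.int.map some) (none :: w.frac.map some)
    rw [List.length_map] at h1
    rw [digitPos_of_le h, toStream, digits, Stream'.get_append_right, Nat.add_assoc, h1]
    rfl

theorem eq_toStream {w : PointedWord D} {s : Stream' (Option D)}
    (h : s.get w.int.length = none)
    (hs : ∀ n, s.get (digitPos w.int.length n) = some (w.digits.get n)) : s = w.toStream := by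
  refine Stream'.ext fun n => ?_
  rcases eq_or_exists_eq_digitPos w.int.length n with rfl | ⟨m, rfl⟩
  · rw [h, toStream_get_length]
  · rw [hs, toStream_get_digitPos]

theorem exists_digits_eq (d : Stream' D) {L : ℕ} (hL : L ≠ 0) :
    ∃ w : PointedWord D, w.int.length = L ∧ w.digits = d :=
  ⟨⟨d.take L, fun h => hL (by simpa using congrArg List.length h), d.drop L⟩,
    Stream'.length_take _ _, Stream'.append_take_drop _ _⟩

theorem exists_eq_prepend (w : PointedWord D) {K : ℕ} (hK : K < w.int.length) :
    ∃ (b : List D) (w' : PointedWord D), b.length = K ∧ w = w'.prepend b :=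
  ⟨w.int.take K, ⟨w.int.drop K, by simpa using hK, w.frac⟩, by simpa using hK.le,
    by simp [prepend]⟩

end PointedWord

/-! ### The transducer, its soundness and completeness -/

/-- The letters of the signed alphabet. -/
abbrev SignedDigit (β : ℝ) : Type := {a : ℤ // a ∈ signedAlphabet β}

section Normalizer

variable {β : ℝ} {C : Finset ℤ}

/-- The digits of `u`, preceded by zeros, paired with the digits of `b w`. -/
def digitPairs (b : List (SignedDigit β)) (u : PointedWord {c : ℤ // c ∈ C})
    (w : PointedWord (SignedDigit β)) : Stream' (ℤ × ℤ) :=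
  (b.map fun a => (0, a.val)) ++ₛ Stream'.zip (fun c a => (c.val, a.val)) u.digits w.digits

variable {b : List (SignedDigit β)} {u : PointedWord {c : ℤ // c ∈ C}}
  {w : PointedWord (SignedDigit β)}

theorem digitPairs_map_fst : (digitPairs b u w).map Prod.fst =
    List.replicate b.length 0 ++ₛ (u.map Subtype.val).digits := by
  rw [digitPairs, Stream'.map_append_stream, List.map_map, PointedWord.digits_map,
    ← List.map_const']
  rfl

theorem digitPairs_map_snd : (digitPairs b u w).map Prod.snd =
    ((w.prepend b).map Subtype.val).digits := by
  rw [digitPairs, Stream'.map_append_stream, List.map_map, PointedWord.digits_map,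
    PointedWord.digits_prepend, Stream'.map_append_stream]
  rfl

theorem digitPairs_get (n : ℕ) : (digitPairs b u w).get (b.length + n) =
    ((u.digits.get n).val, (w.digits.get n).val) := by
  have h := Stream'.get_append_right n (b.map fun a => ((0 : ℤ), a.val))
    (Stream'.zip (fun c a => (c.val, a.val)) u.digits w.digits)
  rw [List.length_map] at h
  exact h

/-- The state after the initial output depends only on `b` and `σ`, which is why it can be imposed
on initial states. -/
theorem normRun_digitPairs (σ : ℤˣ) : normRun β σ (digitPairs b u w) b.length =
    (b.map fun a => ((0 : ℤ), a.val)).foldl (normStep β σ) (0, 1, false) := by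
  have h := Stream'.take_append_of_le_length _ (b.map fun a => ((0 : ℤ), a.val))
    (Stream'.zip (fun c a => (c.val, a.val)) u.digits w.digits) le_rfl
  rw [List.length_map] at h
  rw [normRun, digitPairs, h, List.take_of_length_le (List.length_map _).le]

theorem exists_abs_digit_le (C : Finset ℤ) : ∃ M : ℝ, 0 ≤ M ∧ ∀ c ∈ C, |(c : ℝ)| ≤ M :=
  ⟨∑ c ∈ C, |(c : ℝ)|, Finset.sum_nonneg fun _ _ => abs_nonneg _, fun _ hc =>
    Finset.single_le_sum (f := fun c : ℤ => |(c : ℝ)|) (fun _ _ => abs_nonneg _) hc⟩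

theorem abs_digitPairs_fst_le {M : ℝ} (hM0 : 0 ≤ M) (hM : ∀ c ∈ C, |(c : ℝ)| ≤ M) (i : ℕ) :
    |(((digitPairs b u w).map Prod.fst).get i : ℝ)| ≤ M := by
  rcases lt_or_ge i b.length with h | h
  · rw [digitPairs_map_fst, Stream'.get_append_left _ _ _ (by simpa using h)]
    simpa using hM0
  · obtain ⟨n, rfl⟩ := Nat.exists_eq_add_of_le h
    rw [Stream'.get_map, digitPairs_get]
    exact hM _ (u.digits.get n).2

/-- Padding the input with zeros gives both words the same number of integer digits, so the powers
of `β` and the sign cancel from the equality of values. -/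
theorem isGreedyRep_digitPairs_iff (hβ : 1 < β) (σ : ℤˣ) (hl : w.int.length = u.int.length) :
    IsGreedyRep β (σ * (u.map Subtype.val).val β)
        (((w.prepend b).map Subtype.val).map fun a => (σ : ℤ) * a) ↔
      fracVal β ((digitPairs b u w).map Prod.fst) = fracVal β ((digitPairs b u w).map Prod.snd) ∧
      (∀ i, (((digitPairs b u w).map Prod.snd).map fun a => (σ : ℤ) * a).get i ∈
        canonicalAlphabet β) ∧
      ∀ j, fracVal β ((((digitPairs b u w).map Prod.snd).map fun a => (σ : ℤ) * a).drop j) < 1 := by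
  have h0 : 0 < β := by linarith
  obtain ⟨M, hM0, hM⟩ := exists_abs_digit_le C
  rw [isGreedyRep_iff hβ, PointedWord.digits_map _ ((w.prepend b).map _), ← digitPairs_map_snd]
  refine and_congr_left fun _ => ?_
  have hd : ∀ i, |((u.map Subtype.val).digits.get i : ℝ)| ≤ M := fun i => by
    rw [PointedWord.digits_map]
    exact hM _ (u.digits.get i).2
  rw [fracVal_map_mul, PointedWord.val_eq h0, PointedWord.length_map, PointedWord.length_map,
    PointedWord.length_map, PointedWord.length_prepend, hl, ← pow_mul_fracVal_replicate hβ hd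
    b.length, ← digitPairs_map_fst (w := w)]
  have hσ : ((σ : ℤ) : ℝ) ≠ 0 := Int.cast_ne_zero.2 σ.ne_zero
  have hp : β ^ (b.length + u.int.length) ≠ 0 := by positivity
  constructor
  · intro h
    refine (mul_left_cancel₀ (mul_ne_zero hp hσ) (Eq.trans ?_ (h.trans ?_))).symm <;> ring
  · intro h
    rw [h]
    ring

variable (β C) in
/-- The states of the normalizer: the sign of the output, the part of the output that is written
initially, and a state of the normalization automaton. -/
abbrev NormState (F : Set ℝ) (K : ℕ) : Type :=
  ℤˣ × List.Vector (SignedDigit β) K × F × F × Bool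

namespace NormState

variable {F : Set ℝ} {K : ℕ}

/-- The underlying state of the normalization automaton. -/
def core (q : NormState β F K) : ℝ × ℝ × Bool := (q.2.2.1, q.2.2.2.1, q.2.2.2.2)

variable (C) in
/-- The edges of the normalizer. -/
inductive Edge : NormState β F K → Option {c : ℤ // c ∈ C} × Option (SignedDigit β) →
    NormState β F K → Prop
  | star (q : NormState β F K) : Edge q (none, none) q
  | digit (q q' : NormState β F K) (c : {c : ℤ // c ∈ C}) (a : SignedDigit β) (h1 : q'.1 = q.1)
      (h2 : q'.2.1 = q.2.1) (ha : (q.1 : ℤ) * a ∈ canonicalAlphabet β)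
      (h : q'.core = normStep β q.1 q.core (c, a)) : Edge q (some c, some a) q'

/-- The initial states of the normalizer. -/
def IsInitial (q : NormState β F K) : Prop :=
  (∀ a ∈ q.2.1.toList, (q.1 : ℤ) * a.val ∈ canonicalAlphabet β) ∧
    q.core = (q.2.1.toList.map fun a => ((0 : ℤ), a.val)).foldl (normStep β q.1) (0, 1, false)

end NormState

open Classical in
variable (β C) in
/-- The transducer that realizes the normalization. -/
noncomputable def normalizer (F : Set ℝ) (K : ℕ) :
    LetterTransducer (NormState β F K) (Option {c : ℤ // c ∈ C}) (Option (SignedDigit β)) where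
  edges := {e | NormState.Edge C e.1 e.2.1 e.2.2}
  init q := if q.IsInitial then some ([], q.2.1.toList.map some) else none
  terminal := {q | q.core.2.2 = true}

variable {F : Set ℝ} {K : ℕ}

theorem normalizer_init {q : NormState β F K} {a b} (h : (normalizer β C F K).init q = some (a, b)) :
    q.IsInitial ∧ a = [] ∧ b = q.2.1.toList.map some := by
  simp only [normalizer] at h
  split_ifs at h with hq
  rw [Option.some.injEq, Prod.mk.injEq] at h
  exact ⟨hq, h.1.symm, h.2.symm⟩

/-- Every output of the normalizer is a signed greedy representation of the value of the input. -/
theorem normalizer_sound (hβ : 1 < β) (hF : F.Finite) {v : Stream' (Option (SignedDigit β))}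
    (h : (normalizer β C F K).Accepts u.toStream v) :
    ∃ w : PointedWord (SignedDigit β), v = w.toStream ∧ w.int.length = u.int.length + K ∧
      IsSignedGreedyRep β ((u.map Subtype.val).val β) (w.map Subtype.val) := by
  obtain ⟨q, a, b', u', v', hi, hu, rfl, he, hf⟩ := h
  obtain ⟨⟨hb, hi⟩, rfl, rfl⟩ := normalizer_init hi
  obtain rfl : u.toStream = u' := hu
  set L := u.int.length with hL
  -- Reading `⋆` forces writing `⋆` and staying in place, so skipping this step leaves a run on
  -- digits only.
  have hstar : v'.get L = none ∧ q (L + 1) = q L := by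
    have h : NormState.Edge C (q L) (u.toStream.get L, v'.get L) (q (L + 1)) := he L
    rw [PointedWord.toStream_get_length] at h
    generalize v'.get L = x at h
    generalize q (L + 1) = y at h
    cases h
    exact ⟨rfl, rfl⟩
  let p : ℕ → NormState β F K := fun n => q (PointedWord.digitPos L n)
  have hL0 : 0 < L := List.length_pos_iff.2 u.int_ne_nil
  have hp0 : p 0 = q 0 := by simp [p, PointedWord.digitPos, hL0]
  have hps : ∀ n, p (n + 1) = q (PointedWord.digitPos L n + 1) := by
    intro n
    rcases lt_trichotomy (n + 1) L with h | h | h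
    · simp only [p, PointedWord.digitPos, if_pos h, if_pos (by omega : n < L)]
    · simp only [p, PointedWord.digitPos, h, lt_irrefl, if_false, if_pos (by omega : n < L)]
      exact hstar.2
    · simp only [p, PointedWord.digitPos, if_neg (by omega : ¬n + 1 < L),
        if_neg (by omega : ¬n < L)]
  have hdig : ∀ n, ∃ a : SignedDigit β, v'.get (PointedWord.digitPos L n) = some a ∧
      (p (n + 1)).1 = (p n).1 ∧ (p (n + 1)).2.1 = (p n).2.1 ∧
      ((p n).1 : ℤ) * a ∈ canonicalAlphabet β ∧
      (p (n + 1)).core = normStep β (p n).1 (p n).core ((u.digits.get n).val, a.val) := by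
    intro n
    have h : NormState.Edge C (p n) (u.toStream.get (PointedWord.digitPos L n),
      v'.get (PointedWord.digitPos L n)) (q (PointedWord.digitPos L n + 1)) := he _
    rw [PointedWord.toStream_get_digitPos, ← hps] at h
    generalize v'.get (PointedWord.digitPos L n) = x at h
    generalize p (n + 1) = y at h
    generalize p n = z at h
    cases h with
    | digit _ _ a h1 h2 ha h => exact ⟨a, rfl, h1, h2, ha, h⟩
  choose d hd hσ hbc hA hcore using hdig
  obtain ⟨w, hwl, hwd⟩ := PointedWord.exists_digits_eq (d : Stream' (SignedDigit β)) hL0.ne'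
  have hwg : ∀ n, w.digits.get n = d n := fun n => by rw [hwd]; rfl
  have hv : v' = w.toStream := by
    refine PointedWord.eq_toStream (by rw [hwl]; exact hstar.1) fun n => ?_
    rw [hwl, hd, hwg]
  set b := (q 0).2.1.toList with hbdef
  have hbK : b.length = K := List.Vector.toList_length _
  set σ := (q 0).1
  have hσ' : ∀ n, (p n).1 = σ := by
    intro n
    induction n with
    | zero => rw [hp0]
    | succ n ih => rw [hσ, ih]
  have hrun : ∀ n, (p n).core = normRun β σ (digitPairs b u w) (K + n) := by
    intro n
    induction n with
    | zero => rw [hp0, hi, Nat.add_zero, ← hbK, normRun_digitPairs]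
    | succ n ih => rw [hcore, ih, hσ', ← Nat.add_assoc, normRun_succ, ← hwg, ← hbK, digitPairs_get]
  refine ⟨w.prepend b, ?_, ?_, σ, ?_⟩
  · rw [PointedWord.toStream_prepend, hv]
  · rw [PointedWord.length_prepend, hwl, hbK, add_comm]
  · have hmem : ∀ i, (((digitPairs b u w).map Prod.snd).map fun a => (σ : ℤ) * a).get i ∈
        canonicalAlphabet β := by
      intro i
      rcases lt_or_ge i b.length with h | h
      · rw [digitPairs_map_snd, PointedWord.digits_map, PointedWord.digits_prepend,
          Stream'.get_map, Stream'.get_map, Stream'.get_append_left _ _ _ h]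
        exact hb _ (List.getElem_mem h)
      · obtain ⟨n, rfl⟩ := Nat.exists_eq_add_of_le h
        rw [Stream'.get_map, Stream'.get_map, digitPairs_get]
        simp only [hwg, ← hσ' n]
        exact hA n
    obtain ⟨M, hM0, hM⟩ := exists_abs_digit_le C
    have hs := normRun_sound (σ := σ) (e := digitPairs b u w) (M := max M ⌈β⌉) (K := K) hβ
      (fun i => (abs_digitPairs_fst_le hM0 hM i).trans (le_max_left _ _))
      (fun i => (abs_le_of_signed_mem (hmem i)).trans (le_max_right _ _)) hF
      (fun n => by rw [← hrun]; exact (p n).2.2.1.2)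
      (fun n => by rw [← hrun]; exact (p n).2.2.2.1.2) (by
        -- Beyond `⋆`, path positions exceed digit counts by one, and the automaton is `K` digits
        -- ahead. These shifts do not affect recurrence.
        refine Filter.frequently_atTop.2 fun N => ?_
        obtain ⟨m, hm, hm1⟩ := Filter.frequently_atTop.1 hf (N + L + 1)
        obtain ⟨n, rfl⟩ := Nat.exists_eq_add_of_le hm
        refine ⟨K + (N + L + n), by omega, ?_⟩
        rw [← hrun]
        simp only [p]
        rw [PointedWord.digitPos_of_le (by omega)]
        have e : N + L + n + 1 = N + L + 1 + n := by omega
        rw [e]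
        exact hm1)
    exact (isGreedyRep_digitPairs_iff hβ σ (hwl.trans hL)).2 ⟨hs.1, hmem, hs.2⟩

/-- The normalizer outputs every signed greedy representation of the value of the input. -/
theorem normalizer_complete (hβ : 1 < β) {M : ℝ} (hM0 : 0 ≤ M) (hM : ∀ c ∈ C, |(c : ℝ)| ≤ M)
    (hMβ : ⌈β⌉ ≤ M)
    (hF : ∀ (σ : ℤˣ) (e : Stream' (ℤ × ℤ)),
      (∀ i, |((e.map Prod.fst).get i : ℝ)| ≤ M) → (∀ i, |((e.map Prod.snd).get i : ℝ)| ≤ M) →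
      (∀ n, |(normRun β σ e n).1| ≤ 2 * (M / (β - 1))) → (∀ n, |(normRun β σ e n).2.1| ≤ 1) →
      ∀ n, (normRun β σ e n).1 ∈ F ∧ (normRun β σ e n).2.1 ∈ F)
    {w : PointedWord (SignedDigit β)} (hw : w.int.length = u.int.length + K)
    (h : IsSignedGreedyRep β ((u.map Subtype.val).val β) (w.map Subtype.val)) :
    (normalizer β C F K).Accepts u.toStream w.toStream := by
  set L := u.int.length with hL
  have hL0 : 0 < L := List.length_pos_iff.2 u.int_ne_nil
  obtain ⟨b, w, hb, rfl⟩ := w.exists_eq_prepend (K := K) (by omega)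
  have hwl : w.int.length = L := by rw [PointedWord.length_prepend] at hw; omega
  obtain ⟨σ, h⟩ := h
  obtain ⟨hv, hmem, hg⟩ := (isGreedyRep_digitPairs_iff hβ σ hwl).1 h
  have hc : ∀ i, |(((digitPairs b u w).map Prod.fst).get i : ℝ)| ≤ M :=
    abs_digitPairs_fst_le hM0 hM
  have hd : ∀ i, |(((digitPairs b u w).map Prod.snd).get i : ℝ)| ≤ M := fun i =>
    (abs_le_of_signed_mem (hmem i)).trans hMβ
  obtain ⟨h1, h2, hf⟩ := normRun_complete hβ hc hd
    (fun i => (Finset.mem_Icc.1 (hmem i)).1) hv hg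
  have hFn := hF σ _ hc hd h1 h2
  -- The run is sampled only from its `K`-th state on, since the first `K` output digits are written
  -- by the initial function.
  let p : ℕ → NormState β F K := fun n =>
    (σ, ⟨b, hb⟩, ⟨_, (hFn (K + n)).1⟩, ⟨_, (hFn (K + n)).2⟩,
      (normRun β σ (digitPairs b u w) (K + n)).2.2)
  have hpc : ∀ n, (p n).core = normRun β σ (digitPairs b u w) (K + n) := fun n => rfl
  have hmemb : ∀ i (hi : i < b.length), (σ : ℤ) * b[i].val ∈ canonicalAlphabet β := by
    intro i hi
    have := hmem i
    rwa [digitPairs_map_snd, PointedWord.digits_map, PointedWord.digits_prepend,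
      Stream'.get_map, Stream'.get_map, Stream'.get_append_left _ _ _ hi] at this
  -- Indexing by the number of digits read repeats one state at `⋆`, which gives the loop.
  refine ⟨fun n => p (PointedWord.digitCount L n), [], b.map some, u.toStream, w.toStream, ?_, rfl,
    PointedWord.toStream_prepend b w, fun n => ?_, ?_⟩
  · have hinit : (p 0).IsInitial := by
      constructor
      · intro a ha
        obtain ⟨i, hi, rfl⟩ := List.getElem_of_mem (show a ∈ b from ha)
        exact hmemb i hi
      · rw [hpc, Nat.add_zero]
        conv_lhs => rw [← hb]
        exact normRun_digitPairs σ
    exact if_pos hinit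
  · rcases PointedWord.eq_or_exists_eq_digitPos L n with rfl | ⟨m, rfl⟩
    · have e1 : PointedWord.digitCount L L = L := if_pos le_rfl
      have e2 : PointedWord.digitCount L (L + 1) = L := if_neg (by omega)
      have e3 : w.toStream.get L = none := hwl ▸ w.toStream_get_length
      beta_reduce
      rw [e1, e2, e3, PointedWord.toStream_get_length]
      exact NormState.Edge.star _
    · have e1 : w.toStream.get (PointedWord.digitPos L m) = some (w.digits.get m) :=
        hwl ▸ w.toStream_get_digitPos m
      beta_reduce
      rw [PointedWord.digitCount_digitPos, PointedWord.digitCount_digitPos_succ, e1,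
        PointedWord.toStream_get_digitPos]
      refine NormState.Edge.digit _ _ _ _ rfl rfl ?_ ?_
      · have := hmem (b.length + m)
        rwa [Stream'.get_map, Stream'.get_map, digitPairs_get] at this
      · rw [hpc, hpc, ← Nat.add_assoc, normRun_succ]
        congr 1
        rw [← hb, digitPairs_get]
  · refine Filter.frequently_atTop.2 fun N => ?_
    obtain ⟨m, hm, hm1⟩ := Filter.frequently_atTop.1 hf (K + (N + L + 1))
    obtain ⟨n, rfl⟩ := Nat.exists_eq_add_of_le hm
    refine ⟨PointedWord.digitPos L (N + L + 1 + n), ?_, ?_⟩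
    · rw [PointedWord.digitPos_of_le (by omega)]
      omega
    · beta_reduce
      rw [PointedWord.digitCount_digitPos]
      rw [Nat.add_assoc] at hm1
      exact hm1

/-- A word whose digits are in `S` is a word over the alphabet `S`. -/
theorem PointedWord.exists_map_val_eq {S : Finset ℤ} {w : PointedWord ℤ}
    (h : ∀ j, w.digits.get j ∈ S) : ∃ w' : PointedWord {a : ℤ // a ∈ S}, w'.map Subtype.val = w := by
  classical
  let f : ℤ → {a : ℤ // a ∈ S} := fun a => if ha : a ∈ S then ⟨a, ha⟩ else ⟨_, h 0⟩
  refine ⟨w.map f, PointedWord.ext_digits ?_ (Stream'.ext fun j => ?_)⟩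
  · rw [PointedWord.length_map, PointedWord.length_map]
  · rw [PointedWord.digits_map, PointedWord.digits_map, Stream'.get_map, Stream'.get_map]
    simp only [f, dif_pos (h j)]

/-- The value is `β` to the length times a stream value of modulus at most `M / (β - 1)`. Hence one
number of extra leading digits serves all inputs, as a finite set of initial states requires. -/
theorem exists_abs_val_lt (hβ : 1 < β) {M : ℝ} (hM : ∀ c ∈ C, |(c : ℝ)| ≤ M) :
    ∃ K : ℕ, ∀ u : PointedWord {c : ℤ // c ∈ C},
      |(u.map Subtype.val).val β| < β ^ (u.int.length + K) := by
  have h0 : 0 < β := by linarith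
  obtain ⟨K, hK⟩ := pow_unbounded_of_one_lt (M / (β - 1)) hβ
  refine ⟨K, fun u => ?_⟩
  have hp : 0 < β ^ u.int.length := by positivity
  rw [PointedWord.val_eq h0, PointedWord.length_map, abs_mul, abs_of_pos hp, pow_add]
  refine mul_lt_mul_of_pos_left (lt_of_le_of_lt (abs_fracVal_le hβ fun i => ?_) hK) hp
  rw [PointedWord.digits_map]
  exact hM _ (u.digits.get i).2

end Normalizer

theorem mainTheorem7 (β : ℝ) (hβ : IsPisot β) (C : Finset ℤ) :
    ∃ (Q : Type) (_ : Finite Q)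
      (T : LetterTransducer Q (Option {c : ℤ // c ∈ C}) (Option {a : ℤ // a ∈ signedAlphabet β})),
      (∀ q a b, T.init q = some (a, b) → a = [] ∧ none ∉ b) ∧
      ∀ u : PointedWord {c : ℤ // c ∈ C},
        ∃ v : Stream' (Option {a : ℤ // a ∈ signedAlphabet β}),
          T.Accepts u.toStream v ∧
          (∀ v', T.Accepts u.toStream v' → v' = v) ∧
          ∃ m : ℕ, v.map (Option.map Subtype.val) =
            List.replicate m (some 0) ++ₛ
              (betaExpansion β hβ.one_lt ((u.map Subtype.val).val β)).toStream := by
  have h1 := hβ.one_lt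
  obtain ⟨M, hM0, hM⟩ := exists_abs_digit_le C
  obtain ⟨K, hK⟩ := exists_abs_val_lt h1 hM
  -- The bound must cover the digits of the input and of the output.
  obtain ⟨F, hFin, hF⟩ := hβ.exists_finite_normRun (max M ⌈β⌉)
  have := hFin.to_subtype
  refine ⟨NormState β F K, inferInstance, normalizer β C F K, fun q a b h => ?_, fun u => ?_⟩
  · obtain ⟨-, rfl, rfl⟩ := normalizer_init h
    simp
  · have hL : 0 < u.int.length := List.length_pos_iff.2 u.int_ne_nil
    obtain ⟨m, hlen, hw⟩ := exists_isSignedGreedyRep h1 (by omega) (hK u)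
    obtain ⟨w, hwm⟩ := PointedWord.exists_map_val_eq hw.mem_signedAlphabet
    rw [← hwm, PointedWord.length_map] at hlen
    rw [← hwm] at hw
    refine ⟨w.toStream, ?_, fun v' hv' => ?_, m, ?_⟩
    · exact normalizer_complete h1 (hM0.trans (le_max_left _ _))
        (fun c hc => (hM c hc).trans (le_max_left _ _)) (le_max_right _ _) hF hlen hw
    · obtain ⟨w', rfl, hlen', hw'⟩ := normalizer_sound h1 hFin hv'
      -- Any two outputs have the same length before `⋆`, so uniqueness at fixed length applies even
      -- if the guessed signs differ.
      have e : w'.map Subtype.val = w.map Subtype.val :=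
        hw'.unique h1 hw (by rw [PointedWord.length_map, PointedWord.length_map, hlen, hlen'])
      have e' : w' = w := by
        refine PointedWord.ext_digits (hlen'.trans hlen.symm) (Stream'.ext fun j => ?_)
        have := congrArg (fun w => w.digits.get j) e
        simp only [PointedWord.digits_map, Stream'.get_map] at this
        exact Subtype.ext this
      rw [e']
    · rw [← PointedWord.toStream_map, hwm, PointedWord.toStream_prepend, List.map_replicate]
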